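/- Let $\mathcal D$ be the family of all dyadic intervals $[k2^{-j},(k+1)2^{-j})\subset\mathbb R$, $j,k\in\mathbb Z$, and let $\langle f\rangle_J=\frac1{|J|}\int_J f\,dx$. A weight is a locally integrable function $w$ on $\mathbb R$ with $w>0$ almost everywhere. For a weight $w$ put $$[w]_{A_\infty^d}=\sup_{J\in\mathcal D}\langle w\rangle_J\,e^{-\langle\log w\rangle_J},\qquad [w]_{RH_1^d}=\sup_{J\in\mathcal D}\Big\langle\frac{w}{\langle w\rangle_J}\log\frac{w}{\langle w\rangle_J}\Big\rangle_J,$$ both with values in $[0,\infty]$ (for a weight, $\langle\log w\rangle_J\in[-\infty,\infty)$, and the averages in the second supremum lie in $[0,\infty]$), and write $w\in A_\infty^d$, respectively $w\in RH_1^d$, when the corresponding constant is finite. Theorem. If $w\in A_\infty^d$, then $w\in RH_1^d$ and $$[w]_{RH_1^d}\le \log(16)\,[w]_{A_\infty^d}.$$ The constant $\log 16$ is the best possible: for every real $C<\log 16$ there is a weight $w\in A_\infty^d$ with $[w]_{RH_1^d}>C\,[w]_{A_\infty^d}$. -/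

import Mathlib

open MeasureTheory
open scoped ENNReal NNReal

/-- The dyadic interval `[k 2⁻ʲ, (k+1) 2⁻ʲ)`. The dyadic grid is the family of all of them,
`j` and `k` running over the integers. -/
def dyadicInterval (j k : ℤ) : Set ℝ :=
  Set.Ico ((k : ℝ) * 2 ^ (-j)) (((k : ℝ) + 1) * 2 ^ (-j))

/-- A weight on the real line: a locally integrable function that is positive almost
everywhere with respect to Lebesgue measure. -/
structure IsWeight (w : ℝ → ℝ) : Prop where
  locallyIntegrable : LocallyIntegrable w volume
  pos_ae : ∀ᵐ x ∂(volume : Measure ℝ), 0 < w x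

open Classical in
/-- The dyadic `A_∞` constant `sup_J ⟨w⟩_J exp (-⟨log w⟩_J)`, with values in `[0, ∞]`.
The positive part of `log w` is at most `w`, hence integrable on `J`; so if `log w` is not
integrable on `J`, then `⟨log w⟩_J = -∞` and the quantity at `J` is `∞`. -/
noncomputable def dyadicAInftyConst (w : ℝ → ℝ) : ℝ≥0∞ :=
  ⨆ (j : ℤ) (k : ℤ),
    if IntegrableOn (fun x => Real.log (w x)) (dyadicInterval j k) volume then
      ENNReal.ofReal ((⨍ x in dyadicInterval j k, w x) *
        Real.exp (-(⨍ x in dyadicInterval j k, Real.log (w x))))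
    else ∞

/-- The function `(w / ⟨w⟩_J) log (w / ⟨w⟩_J)`. -/
noncomputable def entropyDensity (w : ℝ → ℝ) (J : Set ℝ) (x : ℝ) : ℝ :=
  (w x / ⨍ t in J, w t) * Real.log (w x / ⨍ t in J, w t)

open Classical in
/-- The dyadic `RH_1` constant `sup_J ⟨(w / ⟨w⟩_J) log (w / ⟨w⟩_J)⟩_J`, with values in
`[0, ∞]`. The integrand is bounded below by `-1/e`; so if it is not integrable on `J`, then
its average is `∞`. The averages are nonnegative by Jensen's inequality, so that
`ENNReal.ofReal` does not change them. -/
noncomputable def dyadicRHOneConst (w : ℝ → ℝ) : ℝ≥0∞ :=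
  ⨆ (j : ℤ) (k : ℤ),
    if IntegrableOn (entropyDensity w (dyadicInterval j k)) (dyadicInterval j k) volume then
      ENNReal.ofReal (⨍ x in dyadicInterval j k, entropyDensity w (dyadicInterval j k) x)
    else ∞

/-- The dyadic Muckenhoupt class `A_∞` of weights. -/
def IsDyadicAInfty (w : ℝ → ℝ) : Prop :=
  IsWeight w ∧ dyadicAInftyConst w < ∞

/-- The dyadic reverse Hölder class `RH_1` of weights. -/
def IsDyadicRHOne (w : ℝ → ℝ) : Prop :=
  IsWeight w ∧ dyadicRHOneConst w < ∞

/-!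
Write `x = ⟨w⟩_J`, `y = ⟨log w⟩_J` and `Q = [w]_{A_∞^d}`, so that every dyadic interval gives a point
of the domain `y ≤ log x ≤ y + log Q`, and the point of an interval is the midpoint of those of its
two halves.

**Upper bound.** The proof is by the Bellman function method: a function `B` on this domain with
`x log x ≤ B(x, y) ≤ x log x + (log 16) Q x` that is midpoint concave along those triples whose
three points all lie in the domain. Iterating midpoint concavity over `n` generations of
subintervals bounds the average of `⟨w⟩_I log ⟨w⟩_I` over the descendants `I` of `J` by `B` at `J`
(`lintegral_levelAverage_le`); Lebesgue differentiation and Fatou's lemma then bound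
`⟨w log w⟩_J - ⟨w⟩_J log ⟨w⟩_J` by `(log 16) Q ⟨w⟩_J`.

The function is `B(x, y) = (log 16) Q x - M(x, log (log 16 · Q) + y)`, where `M` solves a
Monge-Ampère equation: `M(x, Y) = a - x log a`, with `a` the solution of `log a + x / a = Y` on the
branch `a ≥ x / κ`, so that `M` is affine along the lines on which `a` is constant. The number
`κ ≈ 0.81`, a root of `exp κ = (log 16) κ`, makes the branch defined exactly for
`Y - log x ≥ log (log 16)`, that is, for `log x ≤ y + log Q`. After division
by the parameter of the midpoint, midpoint concavity is the inequality `two_point_ineq` for the parameters `r₁, r₂` and abscissae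
`ξ₁, ξ₂` of the two endpoints. If both `ξᵢ ≤ 1`, it follows from the pointwise bound
`r - ξ log r ≥ exp (log r - ξ (1 - 1 / r))` of `exp_le_sub_mul_log`, because the two exponents add
up to `0`. Otherwise one of the `ξᵢ` exceeds `1`, and `far_point_ineq` replaces that bound at this
endpoint; it degenerates to an equality at `ξ = 2 κ`, `r = 2`, which is where the constant `log 16`
comes from.

**Sharpness.** For `1 < a < 2` the weight equal to `a ^ (-m)` on `[2 ^ m, 2 ^ (m + 1))` is constant
on all dyadic intervals of the right half-line but the intervals `[0, 2 ^ N)`, and there it is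
self-similar. Its `A_∞` constant is `1 / (a (2 - a))`, its entropy on `[0, 1)` is
`log (2 - a) + a log a / (2 - a)`, and the quotient of the two tends to `log 16` as `a → 2`.
-/

/-! ### The two-point inequality -/

theorem one_add_mul_log_ge_exp {q : ℝ} (hq : 0 < q) (hq1 : q ≤ 1) :
    Real.exp (q - 1) ≤ 1 + q * Real.log q := by
  have hanti : AntitoneOn (fun s : ℝ => 1 + s * Real.log s - Real.exp (s - 1)) (Set.Ioc 0 1) := by
    have hd : ∀ s ∈ Set.Ioc (0 : ℝ) 1,
        HasDerivAt (fun s : ℝ => 1 + s * Real.log s - Real.exp (s - 1))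
          (Real.log s + 1 - Real.exp (s - 1)) s := by
      intro s hs
      have h1 := Real.hasDerivAt_mul_log hs.1.ne'
      have h2 : HasDerivAt (fun s : ℝ => Real.exp (s - 1)) (Real.exp (s - 1)) s := by
        simpa using ((hasDerivAt_id s).sub_const 1).exp
      exact (h1.const_add 1).sub h2
    refine antitoneOn_of_hasDerivWithinAt_nonpos (convex_Ioc 0 1)
      (fun s hs => (hd s hs).continuousAt.continuousWithinAt)
      (fun s hs => (hd s (interior_subset hs)).hasDerivWithinAt) fun s hs => ?_
    have hs' := interior_subset hs
    have h1 := Real.log_le_sub_one_of_pos hs'.1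
    have h2 := Real.add_one_le_exp (s - 1)
    linarith
  have := hanti ⟨hq, hq1⟩ ⟨one_pos, le_rfl⟩ hq1
  simp at this
  linarith

theorem exp_one_sub_le_one_sub_log {r : ℝ} (hr : 0 < r) (hr1 : r ≤ 1) :
    Real.exp (1 - r) ≤ 1 - Real.log r := by
  have hanti : AntitoneOn (fun s : ℝ => 1 - Real.log s - Real.exp (1 - s)) (Set.Ioc 0 1) := by
    have hd : ∀ s ∈ Set.Ioc (0 : ℝ) 1,
        HasDerivAt (fun s : ℝ => 1 - Real.log s - Real.exp (1 - s))
          (-s⁻¹ + Real.exp (1 - s)) s := by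
      intro s hs
      have h1 := Real.hasDerivAt_log hs.1.ne'
      have h2 : HasDerivAt (fun s : ℝ => Real.exp (1 - s)) (-Real.exp (1 - s)) s := by
        simpa using ((hasDerivAt_id s).const_sub 1).exp
      exact ((h1.const_sub 1).sub h2).congr_deriv (by ring)
    refine antitoneOn_of_hasDerivWithinAt_nonpos (convex_Ioc 0 1)
      (fun s hs => (hd s hs).continuousAt.continuousWithinAt)
      (fun s hs => (hd s (interior_subset hs)).hasDerivWithinAt) fun s hs => ?_
    have hs' := interior_subset hs
    have h1 : Real.exp (1 - s) ≤ s⁻¹ := by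
      rw [show (1 - s) = -(s - 1) by ring, Real.exp_neg]
      have := Real.add_one_le_exp (s - 1)
      exact inv_anti₀ hs'.1 (by linarith)
    linarith
  have := hanti ⟨hr, hr1⟩ ⟨one_pos, le_rfl⟩ hr1
  simp at this
  linarith

/-- The bound for an endpoint of abscissa `ξ ≤ 1`. The left side over `r` is convex in `ξ` and the
right side over `r` affine, with equality at `ξ = 0`, so that only the largest admissible `ξ`,
which is `1` or `r`, has to be examined. -/
theorem exp_le_sub_mul_log {r ξ : ℝ} (hr : 0 < r) (hξ : 0 ≤ ξ) (hξ1 : ξ ≤ 1) (hξr : ξ ≤ r) :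
    Real.exp (Real.log r - ξ * (1 - 1 / r)) ≤ r - ξ * Real.log r := by
  -- convexity reduces the claim at `ξ` to the claim at any larger `m`
  have key : ∀ m : ℝ, 0 < m → ξ ≤ m →
      Real.exp (-(m * (1 - 1 / r))) ≤ 1 - m / r * Real.log r →
      Real.exp (Real.log r - ξ * (1 - 1 / r)) ≤ r - ξ * Real.log r := by
    intro m hm hξm h
    have hθ : ξ / m ≤ 1 := (div_le_one hm).2 hξm
    have hθ0 : 0 ≤ ξ / m := by positivity
    have hc := convexOn_exp.2 (Set.mem_univ (0 : ℝ)) (Set.mem_univ (-(m * (1 - 1 / r))))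
      (sub_nonneg.2 hθ) hθ0 (by ring)
    simp only [smul_eq_mul, mul_zero, zero_add, Real.exp_zero, mul_one] at hc
    have h2 : Real.exp (-(ξ * (1 - 1 / r))) ≤ 1 - ξ / r * Real.log r := by
      calc Real.exp (-(ξ * (1 - 1 / r)))
          = Real.exp (ξ / m * -(m * (1 - 1 / r))) := by congr 1; field_simp
        _ ≤ 1 - ξ / m + ξ / m * Real.exp (-(m * (1 - 1 / r))) := hc
        _ ≤ 1 - ξ / m + ξ / m * (1 - m / r * Real.log r) := by gcongr
        _ = 1 - ξ / r * Real.log r := by field_simp; ring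
    rw [sub_eq_add_neg, Real.exp_add, Real.exp_log hr]
    calc r * Real.exp (-(ξ * (1 - 1 / r))) ≤ r * (1 - ξ / r * Real.log r) := by gcongr
      _ = r - ξ * Real.log r := by field_simp
  rcases le_total 1 r with h1 | h1
  · refine key 1 one_pos hξ1 ?_
    have := one_add_mul_log_ge_exp (q := 1 / r) (by positivity) ((div_le_one hr).2 h1)
    rw [one_div, Real.log_inv] at this
    rw [one_div, one_mul, neg_sub]
    linarith
  · refine key r hr hξr ?_
    have := exp_one_sub_le_one_sub_log hr h1
    rw [div_self hr.ne', one_mul, show -(r * (1 - 1 / r)) = 1 - r by field_simp; ring]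
    exact this

theorem log_sixteen : Real.log 16 = 4 * Real.log 2 := by
  rw [show (16 : ℝ) = 2 ^ 4 by norm_num, Real.log_pow]; norm_num

/-- The equation `exp κ = (log 16) κ` has a second root above `1`; the bounds single out the
smaller one, and the numerical estimates below need its approximate value. -/
theorem exists_exp_eq_log_sixteen_mul :
    ∃ κ : ℝ, 0.8 ≤ κ ∧ κ ≤ 0.85 ∧ Real.exp κ = Real.log 16 * κ := by
  have hcont : ContinuousOn (fun κ : ℝ => Real.log 16 * κ - Real.exp κ) (Set.Icc 0.8 0.85) := by
    fun_prop
  have hl := Real.log_two_gt_d9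
  have hu := Real.log_two_lt_d9
  have h1 : Real.log 16 * 0.8 - Real.exp 0.8 ≤ 0 := by
    have : (2.2254 : ℝ) ≤ Real.exp 0.8 := by
      refine le_trans ?_ (Real.sum_le_exp_of_nonneg (by norm_num) 8)
      norm_num [Finset.sum_range_succ, Nat.factorial]
    rw [log_sixteen]; linarith
  have h2 : 0 ≤ Real.log 16 * 0.85 - Real.exp 0.85 := by
    have : Real.exp 0.85 ≤ 2.34 := by
      refine (Real.exp_bound' (by norm_num) (by norm_num) (n := 8) (by norm_num)).trans ?_
      norm_num [Finset.sum_range_succ, Nat.factorial]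
    rw [log_sixteen]; linarith
  obtain ⟨κ, hκ, h⟩ := intermediate_value_Icc (by norm_num) hcont ⟨h1, h2⟩
  exact ⟨κ, hκ.1, hκ.2, by simp only at h; linarith⟩

/-- A convex second derivative that is nonnegative at `a` and negative at `b` changes sign once, so
`f` is first convex and then concave. On the convex part `f` lies above its zero tangent at `a`,
on the concave part above its chord, whose right end is `0`. -/
theorem nonneg_of_deriv2_convex {f f' f'' : ℝ → ℝ} {a b : ℝ} (hab : a < b)
    (hf : ∀ x ∈ Set.Icc a b, HasDerivAt f (f' x) x)
    (hf' : ∀ x ∈ Set.Icc a b, HasDerivAt f' (f'' x) x)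
    (hcont : ContinuousOn f'' (Set.Icc a b)) (hconv : ConvexOn ℝ (Set.Icc a b) f'')
    (ha : f a = 0) (ha' : f' a = 0) (hb : f b = 0) (ha'' : 0 ≤ f'' a) (hb'' : f'' b < 0) :
    ∀ x ∈ Set.Icc a b, 0 ≤ f x := by
  obtain ⟨s, hs, hs0⟩ := intermediate_value_Icc' hab.le hcont ⟨hb''.le, ha''⟩
  have hsb : s < b := lt_of_le_of_ne hs.2 (by rintro rfl; exact hb''.ne hs0)
  have hleft : ∀ x ∈ Set.Icc a s, 0 ≤ f'' x := by
    intro x hx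
    by_contra! hneg
    have hxs : x < s := lt_of_le_of_ne hx.2 (by rintro rfl; exact hneg.ne hs0)
    have hseg : s ∈ segment ℝ x b := by
      rw [segment_eq_Icc (hxs.trans hsb).le]; exact ⟨hxs.le, hsb.le⟩
    have := hconv.le_on_segment ⟨hx.1, hxs.le.trans hs.2⟩ ⟨hab.le, le_rfl⟩ hseg
    rw [hs0] at this
    exact absurd this (not_le.2 (max_lt hneg hb''))
  have hright : ∀ x ∈ Set.Icc s b, f'' x ≤ 0 := by
    intro x hx
    have hseg : x ∈ segment ℝ s b := by rw [segment_eq_Icc hsb.le]; exact hx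
    have := hconv.le_on_segment hs ⟨hab.le, le_rfl⟩ hseg
    rw [hs0, max_eq_left hb''.le] at this
    exact this
  have hsubl : Set.Icc a s ⊆ Set.Icc a b := Set.Icc_subset_Icc_right hs.2
  have hsubr : Set.Icc s b ⊆ Set.Icc a b := Set.Icc_subset_Icc_left hs.1
  have hmono' : MonotoneOn f' (Set.Icc a s) :=
    monotoneOn_of_hasDerivWithinAt_nonneg (convex_Icc a s)
      (fun x hx => (hf' x (hsubl hx)).continuousAt.continuousWithinAt)
      (fun x hx => (hf' x (hsubl (interior_subset hx))).hasDerivWithinAt)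
      (fun x hx => hleft x (interior_subset hx))
  have hmono : MonotoneOn f (Set.Icc a s) :=
    monotoneOn_of_hasDerivWithinAt_nonneg (convex_Icc a s)
      (fun x hx => (hf x (hsubl hx)).continuousAt.continuousWithinAt)
      (fun x hx => (hf x (hsubl (interior_subset hx))).hasDerivWithinAt)
      (fun x hx => by
        have hx' := interior_subset hx
        rw [← ha']; exact hmono' ⟨le_rfl, hs.1⟩ hx' hx'.1)
  have hl : ∀ x ∈ Set.Icc a s, 0 ≤ f x := fun x hx => by
    rw [← ha]; exact hmono ⟨le_rfl, hs.1⟩ hx hx.1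
  have hanti' : AntitoneOn f' (Set.Icc s b) :=
    antitoneOn_of_hasDerivWithinAt_nonpos (convex_Icc s b)
      (fun x hx => (hf' x (hsubr hx)).continuousAt.continuousWithinAt)
      (fun x hx => (hf' x (hsubr (interior_subset hx))).hasDerivWithinAt)
      (fun x hx => hright x (interior_subset hx))
  have hconc : ConcaveOn ℝ (Set.Icc s b) f := by
    refine AntitoneOn.concaveOn_of_deriv (convex_Icc s b)
      (fun x hx => (hf x (hsubr hx)).continuousAt.continuousWithinAt)
      (fun x hx => (hf x (hsubr (interior_subset hx))).differentiableAt.differentiableWithinAt) ?_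
    intro x hx y hy hxy
    rw [(hf x (hsubr (interior_subset hx))).deriv, (hf y (hsubr (interior_subset hy))).deriv]
    exact hanti' (interior_subset hx) (interior_subset hy) hxy
  intro x hx
  rcases le_total x s with h | h
  · exact hl x ⟨hx.1, h⟩
  · have hseg : x ∈ segment ℝ s b := by rw [segment_eq_Icc hsb.le]; exact ⟨h, hx.2⟩
    have := hconc.ge_on_segment ⟨le_rfl, hsb.le⟩ ⟨hsb.le, le_rfl⟩ hseg
    rw [hb, min_eq_right (hl s ⟨hs.1, le_rfl⟩)] at this
    exact this

/-- The case `ξ = κ r` of `far_point_ineq`, multiplied by `r`. Equality holds at both `r = 1` and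
`r = 2`; the latter is the equation `exp κ = (log 16) κ`. -/
theorem boundary_ineq {κ r : ℝ} (h1 : 0.8 ≤ κ) (h2 : κ ≤ 0.85)
    (hκ : Real.exp κ = Real.log 16 * κ) (hr : r ∈ Set.Icc (1 : ℝ) 2) :
    0 ≤ r ^ 2 - 2 * r + Real.exp (κ * (r - 1)) - κ * (r ^ 2 * Real.log r) := by
  have hl := Real.log_two_gt_d9
  have hu := Real.log_two_lt_d9
  have hexp : ∀ x : ℝ,
      HasDerivAt (fun x => Real.exp (κ * (x - 1))) (κ * Real.exp (κ * (x - 1))) x := by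
    intro x
    have := (((hasDerivAt_id x).sub_const 1).const_mul κ).exp
    exact this.congr_deriv (by simp; ring)
  refine nonneg_of_deriv2_convex
    (f := fun r => r ^ 2 - 2 * r + Real.exp (κ * (r - 1)) - κ * (r ^ 2 * Real.log r))
    (f' := fun r => 2 * r - 2 + κ * Real.exp (κ * (r - 1)) - κ * (2 * (r * Real.log r) + r))
    (f'' := fun r => 2 + κ ^ 2 * Real.exp (κ * (r - 1)) - κ * (2 * Real.log r + 3))
    one_lt_two ?_ ?_ ?_ ?_ ?_ ?_ ?_ ?_ ?_ r hr
  · intro x hx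
    have hx0 : x ≠ 0 := by have := hx.1; positivity
    have h3 := ((hasDerivAt_pow 2 x).mul (Real.hasDerivAt_log hx0)).const_mul κ
    have h4 := (((hasDerivAt_pow 2 x).sub ((hasDerivAt_id x).const_mul 2)).add (hexp x)).sub h3
    refine h4.congr_deriv ?_
    simp
    field_simp
    tauto
  · intro x hx
    have hx0 : x ≠ 0 := by have := hx.1; positivity
    have h3 := (((Real.hasDerivAt_mul_log hx0).const_mul 2).add (hasDerivAt_id x)).const_mul κ
    have h4 := ((((hasDerivAt_id x).const_mul 2).sub_const 2).add ((hexp x).const_mul κ)).sub h3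
    refine h4.congr_deriv ?_
    ring
  · have : ContinuousOn Real.log (Set.Icc (1 : ℝ) 2) :=
      Real.continuousOn_log.mono fun x hx => by
        have := hx.1
        simp; positivity
    fun_prop
  · have hlog : ConcaveOn ℝ (Set.Icc (1 : ℝ) 2) Real.log :=
      strictConcaveOn_log_Ioi.concaveOn.subset
        (fun x hx => lt_of_lt_of_le one_pos hx.1) (convex_Icc 1 2)
    have he : ConvexOn ℝ (Set.Icc (1 : ℝ) 2) (fun r => Real.exp (κ * (r - 1))) := by
      refine ⟨convex_Icc 1 2, fun x _ y _ a b ha hb hab => ?_⟩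
      have := convexOn_exp.2 (Set.mem_univ (κ * (x - 1))) (Set.mem_univ (κ * (y - 1))) ha hb hab
      refine le_trans (le_of_eq ?_) this
      simp only [smul_eq_mul]
      congr 1
      linear_combination κ * hab
    refine ⟨convex_Icc 1 2, fun x hx y hy a b ha hb hab => ?_⟩
    have h3 := hlog.2 hx hy ha hb hab
    have h4 := he.2 hx hy ha hb hab
    simp only [smul_eq_mul] at h3 h4 ⊢
    have h5 := mul_le_mul_of_nonneg_left h3 (show 0 ≤ 2 * κ by linarith)
    have h6 := mul_le_mul_of_nonneg_left h4 (sq_nonneg κ)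
    have hb' : b = 1 - a := by linarith
    subst hb'
    linarith
  · simp; norm_num
  · simp
  · have : Real.exp (κ * (2 - 1)) = 4 * Real.log 2 * κ := by
      rw [← log_sixteen, ← hκ]; norm_num
    simp only [this]; ring
  · simp; nlinarith
  · have : Real.exp (κ * (2 - 1)) = 4 * Real.log 2 * κ := by
      rw [← log_sixteen, ← hκ]; norm_num
    simp only [this]
    -- `2 + 2.7726 κ³ - 4.3862 κ` is convex and negative at `0.8` and `0.85`
    have e1 : κ ^ 2 * (4 * Real.log 2 * κ) ≤ κ ^ 2 * (2.7726 * κ) := by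
      gcongr; linarith
    have e2 : κ * (2 * 0.6931 + 3) ≤ κ * (2 * Real.log 2 + 3) := by
      gcongr; linarith
    nlinarith [mul_nonneg (sub_nonneg.2 h1) (sub_nonneg.2 h2)]

/-- The bound for an endpoint that may have abscissa `ξ > 1`. The difference of the two sides is
increasing in `r`, which reduces the claim to the smallest admissible value `r = ξ / κ`. -/
theorem far_point_ineq {κ ξ r : ℝ} (h1 : 0.8 ≤ κ) (h2 : κ ≤ 0.85)
    (hκ : Real.exp κ = Real.log 16 * κ) (hξ : κ ≤ ξ) (hξ2 : ξ ≤ 2 * κ) (hξr : ξ ≤ κ * r) :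
    2 + ξ * Real.log r ≤ r + Real.exp (-(Real.log r - ξ * (1 - 1 / r))) := by
  have hκ0 : 0 < κ := by linarith
  set r₀ := ξ / κ with hr₀
  have hr₀1 : 1 ≤ r₀ := (one_le_div hκ0).2 hξ
  have hr₀2 : r₀ ≤ 2 := (div_le_iff₀ hκ0).2 hξ2
  have hrr : r₀ ≤ r := (div_le_iff₀ hκ0).2 (by linarith)
  have hξe : ξ = κ * r₀ := by rw [hr₀]; field_simp
  have hmono : MonotoneOn
      (fun s => s + Real.exp (-(Real.log s - ξ * (1 - 1 / s))) - ξ * Real.log s) (Set.Ici r₀) := by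
    have hd : ∀ s ∈ Set.Ici r₀, HasDerivAt
        (fun s => s + Real.exp (-(Real.log s - ξ * (1 - 1 / s))) - ξ * Real.log s)
        ((s - ξ) / s * (1 - Real.exp (-(Real.log s - ξ * (1 - 1 / s))) / s)) s := by
      intro s hs
      have hs0 : s ≠ 0 := by
        have : r₀ ≤ s := hs
        have : 0 < s := by linarith
        exact this.ne'
      have hl := Real.hasDerivAt_log hs0
      have hi : HasDerivAt (fun s : ℝ => 1 / s) (-(s ^ 2)⁻¹) s := by
        simpa [one_div] using hasDerivAt_inv hs0
      have he := ((hl.sub ((hi.const_sub 1).const_mul ξ)).neg).exp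
      refine (((hasDerivAt_id s).add he).sub (hl.const_mul ξ)).congr_deriv ?_
      simp only [Pi.sub_apply, Pi.neg_apply]
      field_simp
      ring
    refine monotoneOn_of_hasDerivWithinAt_nonneg (convex_Ici r₀)
      (fun s hs => (hd s hs).continuousAt.continuousWithinAt)
      (fun s hs => (hd s (interior_subset hs)).hasDerivWithinAt) fun s hs => ?_
    have hs' : r₀ ≤ s := interior_subset hs
    have hs0 : 0 < s := by linarith
    refine mul_nonneg (div_nonneg ?_ hs0.le) (sub_nonneg.2 ((div_le_one hs0).2 ?_))
    · nlinarith
    -- since `ξ ≤ 2 κ < 2`, the exponent is at most `log s`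
    · rw [← Real.le_log_iff_exp_le hs0]
      have h3 := Real.one_sub_inv_le_log_of_pos hs0
      have h4 : 0 ≤ 1 - 1 / s := sub_nonneg.2 ((div_le_one hs0).2 (by linarith))
      rw [← one_div] at h3
      nlinarith
  have hm := hmono (Set.self_mem_Ici) hrr hrr
  have hb := boundary_ineq h1 h2 hκ ⟨hr₀1, hr₀2⟩
  have hr₀0 : 0 < r₀ := by linarith
  have he : Real.exp (-(Real.log r₀ - ξ * (1 - 1 / r₀))) = Real.exp (κ * (r₀ - 1)) / r₀ := by
    rw [neg_sub, Real.exp_sub, Real.exp_log hr₀0, hξe]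
    congr 2
    field_simp
  have : 2 ≤ r₀ + Real.exp (-(Real.log r₀ - ξ * (1 - 1 / r₀))) - ξ * Real.log r₀ := by
    rw [he, ← sub_nonneg]
    have : r₀ + Real.exp (κ * (r₀ - 1)) / r₀ - ξ * Real.log r₀ - 2 =
        (r₀ ^ 2 - 2 * r₀ + Real.exp (κ * (r₀ - 1)) - κ * (r₀ ^ 2 * Real.log r₀)) / r₀ := by
      rw [hξe]; field_simp; ring
    rw [this]; positivity
  simp only at hm
  linarith

/-- Midpoint concavity of the Bellman function in normalized form: `r₁`, `r₂` are the tangency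
parameters and `ξ₁`, `ξ₂` the abscissae of the endpoints, divided by the parameter of the
midpoint. The conditions `ξᵢ ≤ κ rᵢ` and `ξ₁ + ξ₂ ≤ 2 κ` say that the three points lie in the
domain, and `heq` that the ordinate of the midpoint is the mean of the other two. -/
theorem two_point_ineq {κ r₁ r₂ ξ₁ ξ₂ : ℝ} (h1 : 0.8 ≤ κ) (h2 : κ ≤ 0.85)
    (hκ : Real.exp κ = Real.log 16 * κ) (hξ₁ : 0 < ξ₁) (hξ₂ : 0 < ξ₂)
    (hr₁ : ξ₁ ≤ κ * r₁) (hr₂ : ξ₂ ≤ κ * r₂) (hsum : ξ₁ + ξ₂ ≤ 2 * κ)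
    (heq : ξ₁ + ξ₂ = (Real.log r₁ + ξ₁ / r₁) + (Real.log r₂ + ξ₂ / r₂)) :
    2 + (ξ₁ * Real.log r₁ + ξ₂ * Real.log r₂) ≤ r₁ + r₂ := by
  wlog hle : ξ₂ ≤ ξ₁ generalizing r₁ r₂ ξ₁ ξ₂
  · have := this hξ₂ hξ₁ hr₂ hr₁ (by linarith) (by linarith) (by linarith)
    linarith
  have hr₁0 : 0 < r₁ := by by_contra! h; nlinarith
  have hr₂0 : 0 < r₂ := by by_contra! h; nlinarith
  have hE : Real.log r₂ - ξ₂ * (1 - 1 / r₂) = -(Real.log r₁ - ξ₁ * (1 - 1 / r₁)) := by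
    rw [mul_sub, mul_sub, mul_one_div, mul_one_div]; linarith
  have hx₂ := exp_le_sub_mul_log hr₂0 hξ₂.le (by linarith) (by nlinarith)
  rw [hE] at hx₂
  rcases le_total ξ₁ 1 with h | h
  · have hx₁ := exp_le_sub_mul_log hr₁0 hξ₁.le h (by nlinarith)
    have e1 := Real.add_one_le_exp (Real.log r₁ - ξ₁ * (1 - 1 / r₁))
    have e2 := Real.add_one_le_exp (-(Real.log r₁ - ξ₁ * (1 - 1 / r₁)))
    linarith
  · have hx₁ := far_point_ineq h1 h2 hκ (by linarith) (by linarith) hr₁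
    linarith

/-! ### The Bellman function -/

/-- At the left end `a = x / κ` of the branch, `log a + x / a` equals `log (log 16) + log x`, by
`exp κ = (log 16) κ`; from there it grows to infinity. -/
theorem exists_tangency {κ x Y : ℝ} (hκ0 : 0 < κ) (hκ : Real.exp κ = Real.log 16 * κ)
    (hx : 0 < x) (hY : Real.log (Real.log 16) + Real.log x ≤ Y) :
    ∃ a, x ≤ κ * a ∧ Real.log a + x / a = Y := by
  have hc : 0 < Real.log 16 := Real.log_pos (by norm_num)
  have ha₀ : 0 < x / κ := by positivity
  have hpos : ∀ a ∈ Set.Icc (x / κ) (max (x / κ) (Real.exp Y)), a ≠ 0 :=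
    fun a ha => (ha₀.trans_le ha.1).ne'
  have hcont : ContinuousOn (fun a => Real.log a + x / a)
      (Set.Icc (x / κ) (max (x / κ) (Real.exp Y))) :=
    (Real.continuousOn_log.mono fun a ha => hpos a ha).add
      (continuousOn_const.div continuousOn_id hpos)
  have h1 : Real.log (x / κ) + x / (x / κ) ≤ Y := by
    have h2 : κ = Real.log (Real.log 16) + Real.log κ := by
      rw [← Real.log_mul hc.ne' hκ0.ne', ← hκ, Real.log_exp]
    rw [Real.log_div hx.ne' hκ0.ne', div_div_cancel₀ hx.ne']
    linarith
  have h2 : Y ≤ Real.log (max (x / κ) (Real.exp Y)) + x / max (x / κ) (Real.exp Y) := by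
    have h3 : Y ≤ Real.log (max (x / κ) (Real.exp Y)) :=
      (Real.le_log_iff_exp_le (lt_max_of_lt_left ha₀)).2 (le_max_right _ _)
    have : 0 ≤ x / max (x / κ) (Real.exp Y) := by positivity
    linarith
  obtain ⟨a, ha, h⟩ := intermediate_value_Icc (le_max_left _ _) hcont ⟨h1, h2⟩
  refine ⟨a, ?_, h⟩
  have := (div_le_iff₀ hκ0).1 ha.1
  linarith

open Classical in
/-- A parameter `a ≥ x / κ` of an extremal line through `(x, Y)`, that is, a solution of
`log a + x / a = Y`; its value is `0` where there is none. The lemmas use only these two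
properties, so that uniqueness of the solution need not be shown. -/
noncomputable def tangencyParam (κ x Y : ℝ) : ℝ :=
  if h : ∃ a, x ≤ κ * a ∧ Real.log a + x / a = Y then h.choose else 0

theorem tangencyParam_spec {κ x Y : ℝ} (hκ0 : 0 < κ) (hκ : Real.exp κ = Real.log 16 * κ)
    (hx : 0 < x) (hY : Real.log (Real.log 16) + Real.log x ≤ Y) :
    x ≤ κ * tangencyParam κ x Y ∧
      Real.log (tangencyParam κ x Y) + x / tangencyParam κ x Y = Y := by
  have h := exists_tangency hκ0 hκ hx hY
  rw [tangencyParam, dif_pos h]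
  exact h.choose_spec

/-- The Bellman function at `x = ⟨w⟩_J`, `y = ⟨log w⟩_J` for weights with `A_∞` constant `Q`. -/
noncomputable def bellman (κ Q x y : ℝ) : ℝ :=
  Real.log 16 * Q * x -
    (tangencyParam κ x (Real.log (Real.log 16) + Real.log Q + y) -
      x * Real.log (tangencyParam κ x (Real.log (Real.log 16) + Real.log Q + y)))

theorem bellman_bounds {κ Q x y : ℝ} (hκ0 : 0 < κ) (hκ1 : κ ≤ 1)
    (hκ : Real.exp κ = Real.log 16 * κ) (hQ : 0 < Q)
    (hx : 0 < x) (hyx : y ≤ Real.log x) (hxy : Real.log x ≤ y + Real.log Q) :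
    x * Real.log x ≤ bellman κ Q x y ∧
      bellman κ Q x y ≤ x * Real.log x + Real.log 16 * Q * x := by
  have hc : 0 < Real.log 16 := Real.log_pos (by norm_num)
  obtain ⟨h1, h2⟩ := tangencyParam_spec hκ0 hκ hx
    (Y := Real.log (Real.log 16) + Real.log Q + y) (by linarith)
  rw [bellman]
  set a := tangencyParam κ x (Real.log (Real.log 16) + Real.log Q + y)
  have ha : 0 < a := by by_contra! h; nlinarith
  have hxa : x ≤ a := by nlinarith
  have hlog := Real.log_le_log hx hxa
  have hmul := mul_le_mul_of_nonneg_left hlog hx.le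
  constructor
  · have h3 : Real.log a ≤ Real.log (Real.log 16 * Q * x) := by
      rw [Real.log_mul (by positivity) hx.ne', Real.log_mul hc.ne' hQ.ne']
      have : 0 ≤ x / a := by positivity
      linarith
    have := (Real.log_le_log_iff ha (by positivity)).1 h3
    linarith
  · have h3 := Real.log_le_sub_one_of_pos (div_pos ha hx)
    rw [Real.log_div ha.ne' hx.ne'] at h3
    have h4 := mul_le_mul_of_nonneg_left h3 hx.le
    have h5 : x * (a / x - 1) = a - x := by field_simp
    rw [h5] at h4
    linarith

theorem bellman_midpoint {κ Q x x₁ x₂ y y₁ y₂ : ℝ} (h1 : 0.8 ≤ κ) (h2 : κ ≤ 0.85)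
    (hκ : Real.exp κ = Real.log 16 * κ)
    (hx₁ : 0 < x₁) (hx₂ : 0 < x₂) (hx : x = (x₁ + x₂) / 2) (hy : y = (y₁ + y₂) / 2)
    (hu : Real.log x ≤ y + Real.log Q) (hu₁ : Real.log x₁ ≤ y₁ + Real.log Q)
    (hu₂ : Real.log x₂ ≤ y₂ + Real.log Q) :
    (bellman κ Q x₁ y₁ + bellman κ Q x₂ y₂) / 2 ≤ bellman κ Q x y := by
  have hκ0 : 0 < κ := by linarith
  have hx0 : 0 < x := by rw [hx]; positivity
  obtain ⟨p, q⟩ := tangencyParam_spec hκ0 hκ hx0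
    (Y := Real.log (Real.log 16) + Real.log Q + y) (by linarith)
  obtain ⟨p₁, q₁⟩ := tangencyParam_spec hκ0 hκ hx₁
    (Y := Real.log (Real.log 16) + Real.log Q + y₁) (by linarith)
  obtain ⟨p₂, q₂⟩ := tangencyParam_spec hκ0 hκ hx₂
    (Y := Real.log (Real.log 16) + Real.log Q + y₂) (by linarith)
  rw [bellman, bellman, bellman]
  set a := tangencyParam κ x (Real.log (Real.log 16) + Real.log Q + y)
  set a₁ := tangencyParam κ x₁ (Real.log (Real.log 16) + Real.log Q + y₁)
  set a₂ := tangencyParam κ x₂ (Real.log (Real.log 16) + Real.log Q + y₂)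
  have ha : 0 < a := by by_contra! h; nlinarith
  have ha₁ : 0 < a₁ := by by_contra! h; nlinarith
  have ha₂ : 0 < a₂ := by by_contra! h; nlinarith
  have hxa : x / a ≤ κ := (div_le_iff₀ ha).2 p
  have hsum : x₁ / a + x₂ / a = 2 * (x / a) := by rw [hx]; ring
  -- dividing by the midpoint parameter `a` brings the claim to normalized form
  have key := two_point_ineq (r₁ := a₁ / a) (r₂ := a₂ / a) (ξ₁ := x₁ / a) (ξ₂ := x₂ / a) h1 h2 hκ
    (by positivity) (by positivity)
    (by rw [← mul_div_assoc]; gcongr) (by rw [← mul_div_assoc]; gcongr)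
    (by linarith)
    (by
      rw [Real.log_div ha₁.ne' ha.ne', Real.log_div ha₂.ne' ha.ne',
        div_div_div_cancel_right₀ ha.ne', div_div_div_cancel_right₀ ha.ne']
      linarith)
  rw [Real.log_div ha₁.ne' ha.ne', Real.log_div ha₂.ne' ha.ne'] at key
  have h3 := mul_le_mul_of_nonneg_left key ha.le
  have h4 : a * (2 + (x₁ / a * (Real.log a₁ - Real.log a) + x₂ / a * (Real.log a₂ - Real.log a)))
      = 2 * a + (x₁ * (Real.log a₁ - Real.log a) + x₂ * (Real.log a₂ - Real.log a)) := by
    field_simp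
  have h5 : a * (a₁ / a + a₂ / a) = a₁ + a₂ := by field_simp
  rw [h4, h5] at h3
  rw [hx]
  linarith

/-! ### Dyadic intervals and averages over them -/

theorem mem_dyadicInterval {j k : ℤ} {x : ℝ} : x ∈ dyadicInterval j k ↔ ⌊x * 2 ^ j⌋ = k := by
  have h2 : (0 : ℝ) < 2 ^ j := by positivity
  rw [Int.floor_eq_iff, dyadicInterval, Set.mem_Ico, zpow_neg, ← div_eq_mul_inv, ← div_eq_mul_inv,
    div_le_iff₀ h2, lt_div_iff₀ h2]

theorem measurableSet_dyadicInterval (j k : ℤ) : MeasurableSet (dyadicInterval j k) :=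
  measurableSet_Ico

theorem volume_dyadicInterval (j k : ℤ) :
    volume (dyadicInterval j k) = ENNReal.ofReal (2 ^ (-j)) := by
  rw [dyadicInterval, Real.volume_Ico]; congr 1; ring

theorem volume_real_dyadicInterval (j k : ℤ) :
    volume.real (dyadicInterval j k) = 2 ^ (-j) := by
  rw [measureReal_def, volume_dyadicInterval, ENNReal.toReal_ofReal (by positivity)]

theorem integrableOn_const_dyadicInterval (c : ℝ) (j k : ℤ) :
    IntegrableOn (fun _ : ℝ => c) (dyadicInterval j k) :=
  integrableOn_const (by rw [volume_dyadicInterval]; exact ENNReal.ofReal_ne_top)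

theorem dyadicInterval_eq_union (j k : ℤ) :
    dyadicInterval j k = dyadicInterval (j + 1) (2 * k) ∪ dyadicInterval (j + 1) (2 * k + 1) := by
  have h : (2 : ℝ) ^ (-(j + 1)) = 2 ^ (-j) / 2 := by
    rw [neg_add, zpow_add₀ two_ne_zero]; norm_num; ring
  have hp : (0 : ℝ) < 2 ^ (-j) := by positivity
  rw [dyadicInterval, dyadicInterval, dyadicInterval, h]
  push_cast
  have e1 : (2 * (k : ℝ) + 1) * (2 ^ (-j) / 2) = k * 2 ^ (-j) + 2 ^ (-j) / 2 := by ring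
  have e2 : (2 * (k : ℝ) + 1 + 1) * (2 ^ (-j) / 2) = (k + 1) * 2 ^ (-j) := by ring
  have e3 : 2 * (k : ℝ) * (2 ^ (-j) / 2) = k * 2 ^ (-j) := by ring
  rw [e1, e2, e3, Set.Ico_union_Ico_eq_Ico (by linarith) (by linarith)]

theorem disjoint_dyadicInterval (j : ℤ) {k l : ℤ} (h : k ≠ l) :
    Disjoint (dyadicInterval j k) (dyadicInterval j l) :=
  Set.disjoint_left.2 fun _ hx hy =>
    h ((mem_dyadicInterval.1 hx).symm.trans (mem_dyadicInterval.1 hy))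

theorem setAverage_dyadicInterval (f : ℝ → ℝ) (j k : ℤ) :
    ⨍ x in dyadicInterval j k, f x = 2 ^ j * ∫ x in dyadicInterval j k, f x := by
  rw [setAverage_eq, volume_real_dyadicInterval, zpow_neg, inv_inv, smul_eq_mul]

theorem setAverage_dyadicInterval_eq_midpoint {f : ℝ → ℝ} {j k : ℤ}
    (hf : IntegrableOn f (dyadicInterval j k)) :
    ⨍ x in dyadicInterval j k, f x =
      ((⨍ x in dyadicInterval (j + 1) (2 * k), f x) +
        ⨍ x in dyadicInterval (j + 1) (2 * k + 1), f x) / 2 := by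
  rw [dyadicInterval_eq_union, integrableOn_union] at hf
  rw [setAverage_dyadicInterval, setAverage_dyadicInterval, setAverage_dyadicInterval,
    dyadicInterval_eq_union, setIntegral_union (disjoint_dyadicInterval _ (by omega))
      (measurableSet_dyadicInterval _ _) hf.1 hf.2, zpow_add₀ two_ne_zero]
  ring

theorem IsWeight.integrableOn {w : ℝ → ℝ} (hw : IsWeight w) (j k : ℤ) :
    IntegrableOn w (dyadicInterval j k) :=
  (hw.locallyIntegrable.integrableOn_isCompact isCompact_Icc).mono_set Set.Ico_subset_Icc_self

theorem IsWeight.average_pos {w : ℝ → ℝ} (hw : IsWeight w) (j k : ℤ) :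
    0 < ⨍ x in dyadicInterval j k, w x := by
  rw [setAverage_dyadicInterval]
  refine mul_pos (by positivity) ?_
  rw [integral_pos_iff_support_of_nonneg_ae]
  · have hae := ae_restrict_of_ae (s := dyadicInterval j k) hw.pos_ae
    have : (Function.support w : Set ℝ) =ᵐ[volume.restrict (dyadicInterval j k)] Set.univ :=
      Filter.eventuallyEq_set.2 (hae.mono fun x hx => by simp [hx.ne'])
    rw [measure_congr this, Measure.restrict_apply_univ, volume_dyadicInterval]
    simp
    positivity
  · exact (ae_restrict_of_ae hw.pos_ae).mono fun x hx => hx.le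
  · exact hw.integrableOn j k

/-- Jensen's inequality for the logarithm. -/
theorem IsWeight.average_log_le {w : ℝ → ℝ} (hw : IsWeight w) {j k : ℤ}
    (hlog : IntegrableOn (fun x => Real.log (w x)) (dyadicInterval j k)) :
    ⨍ x in dyadicInterval j k, Real.log (w x) ≤ Real.log (⨍ x in dyadicInterval j k, w x) := by
  set A := ⨍ x in dyadicInterval j k, w x with hA
  have hA0 : 0 < A := hw.average_pos j k
  have h2 : (0 : ℝ) < 2 ^ j := by positivity
  have hint := hw.integrableOn j k
  have hconst := integrableOn_const_dyadicInterval (Real.log A - 1) j k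
  have hle : ∫ x in dyadicInterval j k, Real.log (w x) ≤
      ∫ x in dyadicInterval j k, (w x / A + (Real.log A - 1)) := by
    refine integral_mono_ae hlog ((hint.div_const A).add hconst) ?_
    refine (ae_restrict_of_ae hw.pos_ae).mono fun x hx => ?_
    have := Real.log_le_sub_one_of_pos (div_pos hx hA0)
    rw [Real.log_div hx.ne' hA0.ne'] at this
    simp only
    linarith
  rw [integral_add (hint.div_const A) hconst, integral_div, setIntegral_const,
    volume_real_dyadicInterval, smul_eq_mul] at hle
  rw [setAverage_dyadicInterval] at hA ⊢
  calc 2 ^ j * ∫ x in dyadicInterval j k, Real.log (w x)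
      ≤ 2 ^ j * ((∫ x in dyadicInterval j k, w x) / A + 2 ^ (-j) * (Real.log A - 1)) := by gcongr
    _ = (2 ^ j * ∫ x in dyadicInterval j k, w x) / A + (Real.log A - 1) := by
        rw [zpow_neg]; field_simp
    _ = Real.log A := by rw [← hA, div_self hA0.ne']; ring

open Classical in
theorem IsDyadicAInfty.integrableOn_log {w : ℝ → ℝ} (hw : IsDyadicAInfty w) (j k : ℤ) :
    IntegrableOn (fun x => Real.log (w x)) (dyadicInterval j k) := by
  by_contra h
  have h1 := hw.2
  rw [dyadicAInftyConst] at h1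
  have h2 := (le_iSup₂ (f := fun j k : ℤ =>
    if IntegrableOn (fun x => Real.log (w x)) (dyadicInterval j k) volume then
      ENNReal.ofReal ((⨍ x in dyadicInterval j k, w x) *
        Real.exp (-(⨍ x in dyadicInterval j k, Real.log (w x))))
    else ∞) j k).trans_lt h1
  rw [if_neg h] at h2
  exact lt_irrefl _ h2

open Classical in
theorem IsDyadicAInfty.mul_exp_le {w : ℝ → ℝ} (hw : IsDyadicAInfty w) (j k : ℤ) :
    (⨍ x in dyadicInterval j k, w x) * Real.exp (-(⨍ x in dyadicInterval j k, Real.log (w x))) ≤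
      (dyadicAInftyConst w).toReal := by
  rw [← ENNReal.ofReal_le_iff_le_toReal hw.2.ne]
  have h2 := (le_iSup₂ (f := fun j k : ℤ =>
    if IntegrableOn (fun x => Real.log (w x)) (dyadicInterval j k) volume then
      ENNReal.ofReal ((⨍ x in dyadicInterval j k, w x) *
        Real.exp (-(⨍ x in dyadicInterval j k, Real.log (w x))))
    else ∞) j k)
  rwa [if_pos (hw.integrableOn_log j k)] at h2

theorem IsDyadicAInfty.const_pos {w : ℝ → ℝ} (hw : IsDyadicAInfty w) :
    0 < (dyadicAInftyConst w).toReal :=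
  lt_of_lt_of_le (mul_pos (hw.1.average_pos 0 0) (Real.exp_pos _)) (hw.mul_exp_le 0 0)

theorem IsDyadicAInfty.log_average_le {w : ℝ → ℝ} (hw : IsDyadicAInfty w) (j k : ℤ) :
    Real.log (⨍ x in dyadicInterval j k, w x) ≤
      (⨍ x in dyadicInterval j k, Real.log (w x)) + Real.log (dyadicAInftyConst w).toReal := by
  have h0 := hw.1.average_pos j k
  have h := Real.log_le_log (mul_pos h0 (Real.exp_pos _)) (hw.mul_exp_le j k)
  rw [Real.log_mul h0.ne' (Real.exp_pos _).ne', Real.log_exp] at h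
  linarith

/-! ### The induction over dyadic generations -/

/-- The average of `w` over the dyadic interval of length `2⁻ᵐ` that contains `x`. -/
noncomputable def levelAverage (w : ℝ → ℝ) (m : ℤ) (x : ℝ) : ℝ :=
  ⨍ t in dyadicInterval m ⌊x * 2 ^ m⌋, w t

theorem measurable_levelAverage (w : ℝ → ℝ) (m : ℤ) : Measurable (levelAverage w m) :=
  (measurable_from_top (f := fun k : ℤ => ⨍ t in dyadicInterval m k, w t)).comp
    (Int.measurable_floor.comp (measurable_id.mul_const _))

/-- The summand `1` makes `s log s` nonnegative, so that the Lebesgue integral and Fatou's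
lemma apply. -/
theorem mul_log_add_one_nonneg {s : ℝ} (hs : 0 < s) : 0 ≤ s * Real.log s + 1 := by
  have h := mul_le_mul_of_nonneg_left (Real.one_sub_inv_le_log_of_pos hs) hs.le
  rw [mul_sub, mul_inv_cancel₀ hs.ne'] at h
  linarith

/-- The Bellman induction: each halving of the intervals is one use of `bellman_midpoint`. -/
theorem lintegral_levelAverage_le {w : ℝ → ℝ} (hw : IsDyadicAInfty w) {κ : ℝ} (h1 : 0.8 ≤ κ)
    (h2 : κ ≤ 0.85) (hκ : Real.exp κ = Real.log 16 * κ) (n : ℕ) (j k : ℤ) :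
    ∫⁻ x in dyadicInterval j k,
        ENNReal.ofReal (levelAverage w (j + n) x * Real.log (levelAverage w (j + n) x) + 1) ≤
      ENNReal.ofReal (2 ^ (-j) * (bellman κ (dyadicAInftyConst w).toReal
        (⨍ x in dyadicInterval j k, w x) (⨍ x in dyadicInterval j k, Real.log (w x)) + 1)) := by
  have hbound : ∀ j k : ℤ, _ := fun j k => bellman_bounds (κ := κ) (by linarith) (by linarith) hκ
    hw.const_pos (hw.1.average_pos j k) (hw.1.average_log_le (hw.integrableOn_log j k))
    (hw.log_average_le j k)
  induction n generalizing j k with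
  | zero =>
    have hc : Set.EqOn (fun x => ENNReal.ofReal
        (levelAverage w (j + (0 : ℕ)) x * Real.log (levelAverage w (j + (0 : ℕ)) x) + 1))
        (fun _ => ENNReal.ofReal ((⨍ x in dyadicInterval j k, w x) *
          Real.log (⨍ x in dyadicInterval j k, w x) + 1)) (dyadicInterval j k) := by
      intro x hx
      simp only [Nat.cast_zero, add_zero, levelAverage, mem_dyadicInterval.1 hx]
    rw [setLIntegral_congr_fun (measurableSet_dyadicInterval j k) hc, setLIntegral_const,
      volume_dyadicInterval, mul_comm, ← ENNReal.ofReal_mul (by positivity)]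
    refine ENNReal.ofReal_le_ofReal ?_
    have := (hbound j k).1
    gcongr
  | succ n ih =>
    have e : j + ((n + 1 : ℕ) : ℤ) = j + 1 + n := by push_cast; ring
    rw [e]
    have hl := ih (j + 1) (2 * k)
    have hr := ih (j + 1) (2 * k + 1)
    have hmid := bellman_midpoint h1 h2 hκ (hw.1.average_pos (j + 1) (2 * k))
      (hw.1.average_pos (j + 1) (2 * k + 1))
      (setAverage_dyadicInterval_eq_midpoint (hw.1.integrableOn j k))
      (setAverage_dyadicInterval_eq_midpoint (hw.integrableOn_log j k))
      (hw.log_average_le j k) (hw.log_average_le _ _) (hw.log_average_le _ _)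
    have hnn : ∀ l : ℤ, 0 ≤ (2 : ℝ) ^ (-(j + 1)) * (bellman κ (dyadicAInftyConst w).toReal
        (⨍ x in dyadicInterval (j + 1) l, w x)
        (⨍ x in dyadicInterval (j + 1) l, Real.log (w x)) + 1) := fun l => by
      have a1 := mul_log_add_one_nonneg (hw.1.average_pos (j + 1) l)
      have a2 := (hbound (j + 1) l).1
      exact mul_nonneg (by positivity) (by linarith)
    nth_rewrite 1 [dyadicInterval_eq_union]
    rw [lintegral_union (measurableSet_dyadicInterval _ _)
      (disjoint_dyadicInterval _ (by omega))]
    refine (add_le_add hl hr).trans ?_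
    rw [← ENNReal.ofReal_add (hnn _) (hnn _)]
    refine ENNReal.ofReal_le_ofReal ?_
    rw [neg_add, zpow_add₀ two_ne_zero]
    have hp : (0 : ℝ) < 2 ^ (-j) := by positivity
    have := mul_le_mul_of_nonneg_left hmid hp.le
    rw [show (2 : ℝ) ^ (-1 : ℤ) = 1 / 2 by norm_num]
    linarith

/-- Up to an endpoint, dyadic intervals are closed balls around their midpoints, so Lebesgue's
differentiation theorem for non-centred balls applies. -/
theorem ae_tendsto_levelAverage {w : ℝ → ℝ} (hw : LocallyIntegrable w) (j : ℤ) :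
    ∀ᵐ x, Filter.Tendsto (fun n : ℕ => levelAverage w (j + n) x) Filter.atTop (nhds (w x)) := by
  filter_upwards [IsUnifLocDoublingMeasure.ae_tendsto_average (μ := volume) hw 1] with x hx
  have hr : ∀ m : ℤ, (0 : ℝ) < 2 ^ (-m) / 2 := fun m => by positivity
  have hδ : Filter.Tendsto (fun n : ℕ => (2 : ℝ) ^ (-(j + n)) / 2) Filter.atTop
      (nhdsWithin 0 (Set.Ioi 0)) := by
    refine tendsto_nhdsWithin_iff.2 ⟨?_, Filter.Eventually.of_forall fun n => hr _⟩
    have h := (tendsto_pow_atTop_nhds_zero_of_lt_one (r := (1 / 2 : ℝ)) (by norm_num)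
      (by norm_num)).const_mul ((2 : ℝ) ^ (-j) / 2)
    rw [mul_zero] at h
    refine h.congr fun n => ?_
    rw [neg_add, zpow_add₀ two_ne_zero, zpow_neg _ (n : ℤ), zpow_natCast, one_div, inv_pow]
    ring
  have hball : ∀ m k : ℤ, Metric.closedBall (((k : ℝ) + 1 / 2) * 2 ^ (-m)) ((2 : ℝ) ^ (-m) / 2) =
      Set.Icc ((k : ℝ) * 2 ^ (-m)) (((k : ℝ) + 1) * 2 ^ (-m)) := by
    intro m k
    rw [Real.closedBall_eq_Icc]
    congr 1 <;> ring
  have h := hx (fun n : ℕ => ((⌊x * 2 ^ (j + n)⌋ : ℝ) + 1 / 2) * 2 ^ (-(j + n)))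
    (fun n : ℕ => (2 : ℝ) ^ (-(j + n)) / 2) hδ (Filter.Eventually.of_forall fun n => by
      rw [one_mul, hball]
      exact Set.Ico_subset_Icc_self (mem_dyadicInterval.2 rfl))
  refine h.congr fun n => ?_
  rw [hball, levelAverage, dyadicInterval]
  exact setAverage_congr Ico_ae_eq_Icc.symm

/-- The limit of the Bellman induction as the number of generations tends to infinity, by Fatou's
lemma. -/
theorem IsDyadicAInfty.lintegral_mul_log_le {w : ℝ → ℝ} (hw : IsDyadicAInfty w) (j k : ℤ) :
    ∫⁻ x in dyadicInterval j k, ENNReal.ofReal (w x * Real.log (w x) + 1) ≤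
      ENNReal.ofReal (2 ^ (-j) * ((⨍ x in dyadicInterval j k, w x) *
        Real.log (⨍ x in dyadicInterval j k, w x) +
          Real.log 16 * (dyadicAInftyConst w).toReal * (⨍ x in dyadicInterval j k, w x) + 1)) := by
  obtain ⟨κ, h1, h2, hκ⟩ := exists_exp_eq_log_sixteen_mul
  have hcont : Continuous fun s : ℝ => ENNReal.ofReal (s * Real.log s + 1) :=
    ENNReal.continuous_ofReal.comp (Real.continuous_mul_log.add_const 1)
  have hmeas : ∀ n : ℕ, Measurable fun x => ENNReal.ofReal
      (levelAverage w (j + n) x * Real.log (levelAverage w (j + n) x) + 1) := fun n =>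
    hcont.measurable.comp (measurable_levelAverage w (j + n))
  calc ∫⁻ x in dyadicInterval j k, ENNReal.ofReal (w x * Real.log (w x) + 1)
      = ∫⁻ x in dyadicInterval j k, Filter.liminf (fun n : ℕ => ENNReal.ofReal
          (levelAverage w (j + n) x * Real.log (levelAverage w (j + n) x) + 1)) Filter.atTop := by
        refine lintegral_congr_ae (ae_restrict_of_ae ?_)
        filter_upwards [ae_tendsto_levelAverage hw.1.locallyIntegrable j] with x hx
        exact ((hcont.tendsto (w x)).comp hx).liminf_eq.symm
    _ ≤ Filter.liminf (fun n : ℕ => ∫⁻ x in dyadicInterval j k, ENNReal.ofReal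
          (levelAverage w (j + n) x * Real.log (levelAverage w (j + n) x) + 1)) Filter.atTop :=
        lintegral_liminf_le hmeas
    _ ≤ _ := by
        refine Filter.liminf_le_of_le (by isBoundedDefault) fun b hb => ?_
        obtain ⟨n, hn⟩ := hb.exists
        refine hn.trans ((lintegral_levelAverage_le hw h1 h2 hκ n j k).trans ?_)
        refine ENNReal.ofReal_le_ofReal ?_
        have := (bellman_bounds (κ := κ) (by linarith) (by linarith) hκ
          hw.const_pos (hw.1.average_pos j k) (hw.1.average_log_le (hw.integrableOn_log j k))
          (hw.log_average_le j k)).2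
        gcongr

theorem IsDyadicAInfty.integrableOn_mul_log {w : ℝ → ℝ} (hw : IsDyadicAInfty w) (j k : ℤ) :
    IntegrableOn (fun x => w x * Real.log (w x)) (dyadicInterval j k) := by
  have hm : AEStronglyMeasurable (fun x => w x * Real.log (w x) + 1)
      (volume.restrict (dyadicInterval j k)) :=
    (Real.continuous_mul_log.add_const 1).comp_aestronglyMeasurable
      (hw.1.integrableOn j k).aestronglyMeasurable
  have hi : IntegrableOn (fun x => w x * Real.log (w x) + 1) (dyadicInterval j k) := by
    refine ⟨hm, ?_⟩
    rw [hasFiniteIntegral_iff_ofReal]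
    · exact (hw.lintegral_mul_log_le j k).trans_lt ENNReal.ofReal_lt_top
    · exact ae_restrict_of_ae (hw.1.pos_ae.mono fun x hx => mul_log_add_one_nonneg hx)
  simpa [Pi.sub_def] using hi.sub (integrableOn_const_dyadicInterval 1 j k)

theorem IsDyadicAInfty.average_mul_log_le {w : ℝ → ℝ} (hw : IsDyadicAInfty w) (j k : ℤ) :
    ⨍ x in dyadicInterval j k, w x * Real.log (w x) ≤
      (⨍ x in dyadicInterval j k, w x) * Real.log (⨍ x in dyadicInterval j k, w x) +
        Real.log 16 * (dyadicAInftyConst w).toReal * (⨍ x in dyadicInterval j k, w x) := by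
  have h := hw.lintegral_mul_log_le j k
  have hc : 0 < Real.log 16 := Real.log_pos (by norm_num)
  have ha := hw.1.average_pos j k
  have hi := hw.integrableOn_mul_log j k
  have hconst := integrableOn_const_dyadicInterval 1 j k
  have hadd : IntegrableOn (fun x => w x * Real.log (w x) + 1) (dyadicInterval j k) :=
    hi.add hconst
  rw [← ofReal_integral_eq_lintegral_ofReal hadd
      (ae_restrict_of_ae (hw.1.pos_ae.mono fun x hx => mul_log_add_one_nonneg hx)),
    ENNReal.ofReal_le_ofReal_iff, integral_add hi hconst, setIntegral_const,
    volume_real_dyadicInterval, smul_eq_mul, mul_one] at h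
  · rw [setAverage_dyadicInterval (fun x => w x * Real.log (w x))]
    have h2 := mul_le_mul_of_nonneg_left h (show (0 : ℝ) ≤ 2 ^ j by positivity)
    rw [← mul_assoc, mul_add, zpow_neg, mul_inv_cancel₀ (by positivity)] at h2
    linarith
  · have := mul_log_add_one_nonneg ha
    have hQ := hw.const_pos
    have : 0 ≤ Real.log 16 * (dyadicAInftyConst w).toReal * ⨍ x in dyadicInterval j k, w x := by
      positivity
    exact mul_nonneg (by positivity) (by linarith)

/-! ### The entropy averages -/

theorem entropyDensity_eq {w : ℝ → ℝ} {J : Set ℝ} (hJ : 0 < ⨍ t in J, w t) {x : ℝ}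
    (hx : 0 < w x) :
    entropyDensity w J x = (⨍ t in J, w t)⁻¹ * (w x * Real.log (w x)) -
      Real.log (⨍ t in J, w t) * (⨍ t in J, w t)⁻¹ * w x := by
  rw [entropyDensity, Real.log_div hx.ne' hJ.ne']; ring

theorem integrableOn_entropyDensity {w : ℝ → ℝ} (hw : IsWeight w) {j k : ℤ}
    (hi : IntegrableOn (fun x => w x * Real.log (w x)) (dyadicInterval j k)) :
    IntegrableOn (entropyDensity w (dyadicInterval j k)) (dyadicInterval j k) :=
  ((hi.const_mul _).sub ((hw.integrableOn j k).const_mul _)).congr <|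
    (ae_restrict_of_ae hw.pos_ae).mono fun _ hx =>
      (entropyDensity_eq (hw.average_pos j k) hx).symm

theorem average_entropyDensity {w : ℝ → ℝ} (hw : IsWeight w) {j k : ℤ}
    (hi : IntegrableOn (fun x => w x * Real.log (w x)) (dyadicInterval j k)) :
    ⨍ x in dyadicInterval j k, entropyDensity w (dyadicInterval j k) x =
      (⨍ x in dyadicInterval j k, w x * Real.log (w x)) / (⨍ x in dyadicInterval j k, w x) -
        Real.log (⨍ x in dyadicInterval j k, w x) := by
  have hA := hw.average_pos j k
  rw [setAverage_dyadicInterval, integral_congr_ae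
    ((ae_restrict_of_ae hw.pos_ae).mono fun _ hx => entropyDensity_eq hA hx),
    integral_sub (hi.const_mul _) ((hw.integrableOn j k).const_mul _),
    integral_const_mul, integral_const_mul, mul_sub,
    setAverage_dyadicInterval (fun x => w x * Real.log (w x))]
  have h := setAverage_dyadicInterval w j k
  set A := ⨍ x in dyadicInterval j k, w x
  have : Real.log A = Real.log A * A⁻¹ * (2 ^ j * ∫ x in dyadicInterval j k, w x) := by
    rw [← h]; field_simp
  linear_combination this

theorem IsDyadicAInfty.dyadicRHOneConst_le {w : ℝ → ℝ} (hw : IsDyadicAInfty w) :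
    dyadicRHOneConst w ≤ ENNReal.ofReal (Real.log 16) * dyadicAInftyConst w := by
  refine iSup₂_le fun j k => ?_
  have hi := hw.integrableOn_mul_log j k
  have hA := hw.1.average_pos j k
  rw [if_pos (integrableOn_entropyDensity hw.1 hi), average_entropyDensity hw.1 hi,
    ← ENNReal.ofReal_toReal hw.2.ne, ← ENNReal.ofReal_mul (Real.log_nonneg (by norm_num))]
  refine ENNReal.ofReal_le_ofReal ?_
  rw [sub_le_iff_le_add, div_le_iff₀ hA]
  have := hw.average_mul_log_le j k
  linarith

/-! ### A family of nearly extremal weights -/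

theorem int_log_two_eq_iff {x : ℝ} (hx : 0 < x) {z : ℤ} :
    Int.log 2 x = z ↔ (2 : ℝ) ^ z ≤ x ∧ x < 2 ^ (z + 1) := by
  have h1 := Int.zpow_le_iff_le_log (R := ℝ) (b := 2) (by norm_num) (x := z) hx
  have h2 := Int.lt_zpow_iff_log_lt (R := ℝ) (b := 2) (by norm_num) (x := z + 1) hx
  push_cast at h1 h2
  rw [h1, h2]
  omega

theorem int_log_two_of_mem_dyadicInterval {m k : ℤ} (hk : 1 ≤ k) {x : ℝ}
    (hx : x ∈ dyadicInterval m k) : Int.log 2 x = Int.log 2 (k : ℝ) - m := by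
  obtain ⟨h1, h2⟩ := hx
  have hk0 : (0 : ℝ) < k := by exact_mod_cast hk
  have hx0 : 0 < x := lt_of_lt_of_le (by positivity) h1
  obtain ⟨h3, h4⟩ := (int_log_two_eq_iff hk0).1 rfl
  set l := Int.log 2 (k : ℝ)
  have hl : 0 ≤ l := by
    by_contra! h
    have : (2 : ℝ) ^ (l + 1) ≤ 2 ^ (0 : ℤ) := zpow_le_zpow_right₀ one_le_two (by omega)
    have h5 : (1 : ℝ) ≤ k := by exact_mod_cast hk
    rw [zpow_zero] at this
    linarith
  have h5 : (k : ℝ) + 1 ≤ 2 ^ (l + 1) := by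
    obtain ⟨n, hn⟩ := Int.eq_ofNat_of_zero_le hl
    rw [hn] at h4 ⊢
    norm_cast at h4 ⊢
  have hp : (0 : ℝ) < 2 ^ (-m) := by positivity
  rw [int_log_two_eq_iff hx0]
  rw [show l - m = l + -m by ring, show l + -m + 1 = (l + 1) + -m by ring,
    zpow_add₀ two_ne_zero, zpow_add₀ two_ne_zero (l + 1)]
  exact ⟨(mul_le_mul_of_nonneg_right h3 hp.le).trans h1,
    h2.trans_le (mul_le_mul_of_nonneg_right h5 hp.le)⟩

/-- The half-open intervals `[2 ^ m, 2 ^ (m + 1))` with `m < -j` fill `(0, 2 ^ (-j))`. -/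
theorem iUnion_dyadicInterval_one (j : ℤ) :
    ⋃ n : ℕ, dyadicInterval (j + n + 1) 1 = Set.Ioo 0 (2 ^ (-j)) := by
  ext x
  simp only [Set.mem_iUnion, Set.mem_Ioo]
  have h1 : ∀ m : ℤ, x ∈ dyadicInterval m 1 ↔ (2 : ℝ) ^ (-m) ≤ x ∧ x < 2 ^ (-m + 1) := by
    intro m
    rw [dyadicInterval, Set.mem_Ico, zpow_add₀ two_ne_zero]
    norm_num [mul_comm]
  constructor
  · rintro ⟨n, hn⟩
    rw [h1] at hn
    refine ⟨lt_of_lt_of_le (by positivity) hn.1, hn.2.trans_le ?_⟩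
    exact zpow_le_zpow_right₀ one_le_two (by omega)
  · rintro ⟨h2, h3⟩
    have h4 : Int.log 2 x < -j := by
      rw [← Int.lt_zpow_iff_log_lt (by norm_num) h2]
      exact_mod_cast h3
    refine ⟨(-j - 1 - Int.log 2 x).toNat, ?_⟩
    rw [h1, ← int_log_two_eq_iff h2, Int.toNat_of_nonneg (by omega)]
    ring

theorem dyadicInterval_zero_ae_eq (j : ℤ) :
    dyadicInterval j 0 =ᵐ[volume] ⋃ n : ℕ, dyadicInterval (j + n + 1) 1 := by
  rw [iUnion_dyadicInterval_one, dyadicInterval]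
  simpa using (Ioo_ae_eq_Ico (μ := volume) (a := (0 : ℝ)) (b := 2 ^ (-j))).symm

theorem hasSum_affine_mul_geometric {r : ℝ} (hr0 : 0 ≤ r) (hr : r < 1) (α β : ℝ) :
    HasSum (fun n : ℕ => (α + β * (n + 1)) * r ^ (n + 1))
      (α * (r / (1 - r)) + β * (r / (1 - r) ^ 2)) := by
  have h1 := ((hasSum_geometric_of_lt_one hr0 hr).mul_left r).mul_left α
  have h2 : HasSum (fun n : ℕ => ((n + 1 : ℕ) : ℝ) * r ^ (n + 1)) (r / (1 - r) ^ 2) := by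
    rw [hasSum_nat_add_iff (f := fun n : ℕ => (n : ℝ) * r ^ n) 1]
    simpa using hasSum_coe_mul_geometric_of_norm_lt_one
      (by rw [Real.norm_eq_abs, abs_of_nonneg hr0]; exact hr)
  refine ((h1.add (h2.mul_left β)).congr_fun fun n => ?_)
  push_cast
  ring

/-- On `[0, 2 ^ (-j))`, the averages of the weight, of its logarithm and of their product are all
sums of this arithmetico-geometric type. -/
theorem average_of_eq_affine_mul_pow {f : ℝ → ℝ} {j : ℤ} {α β ρ : ℝ} (hρ0 : 0 < ρ) (hρ : ρ < 2)
    (hf : ∀ n : ℕ, ∀ x ∈ dyadicInterval (j + n + 1) 1, f x = (α + β * (n + 1)) * ρ ^ (n + 1)) :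
    IntegrableOn f (dyadicInterval j 0) ∧ ⨍ x in dyadicInterval j 0, f x =
      α * (ρ / (2 - ρ)) + β * (2 * ρ / (2 - ρ) ^ 2) := by
  have hsum := hasSum_affine_mul_geometric (r := ρ / 2) (by positivity) (by linarith) α β
  have hmeas : ∀ n : ℕ, MeasurableSet (dyadicInterval (j + n + 1) 1) :=
    fun n => measurableSet_dyadicInterval _ _
  have hdisj : Pairwise (Function.onFun Disjoint fun n : ℕ => dyadicInterval (j + n + 1) 1) := by
    intro m n hmn
    refine Set.disjoint_left.2 fun x hx hy => hmn ?_
    have h1 := int_log_two_of_mem_dyadicInterval le_rfl hx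
    have h2 := int_log_two_of_mem_dyadicInterval le_rfl hy
    omega
  have hvol : ∀ n : ℕ, (2 : ℝ) ^ (-(j + n + 1)) = 2 ^ (-j) * (1 / 2) ^ (n + 1) := by
    intro n
    rw [show -(j + n + 1) = -j + -((n + 1 : ℕ) : ℤ) by push_cast; ring, zpow_add₀ two_ne_zero,
      zpow_neg _ ((n + 1 : ℕ) : ℤ), zpow_natCast, one_div, inv_pow]
  have hint : ∀ n : ℕ, IntegrableOn f (dyadicInterval (j + n + 1) 1) := fun n =>
    (integrableOn_const_dyadicInterval _ _ _).congr_fun (fun x hx => (hf n x hx).symm) (hmeas n)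
  have hval : ∀ n : ℕ, ∫ x in dyadicInterval (j + n + 1) 1, f x =
      2 ^ (-j) * ((α + β * (n + 1)) * (ρ / 2) ^ (n + 1)) := by
    intro n
    rw [setIntegral_congr_fun (hmeas n) (hf n), setIntegral_const, volume_real_dyadicInterval,
      smul_eq_mul, hvol]
    ring
  have hnorm : ∀ n : ℕ, ∫ x in dyadicInterval (j + n + 1) 1, ‖f x‖ =
      2 ^ (-j) * ‖(α + β * (n + 1)) * (ρ / 2) ^ (n + 1)‖ := by
    intro n
    rw [setIntegral_congr_fun (g := fun _ => ‖(α + β * (n + 1)) * ρ ^ (n + 1)‖) (hmeas n)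
      (fun x hx => by simp only [hf n x hx]), setIntegral_const, volume_real_dyadicInterval,
      smul_eq_mul, hvol, norm_mul, norm_mul, norm_pow, norm_pow, norm_div, Real.norm_two]
    ring
  have hI : IntegrableOn f (⋃ n : ℕ, dyadicInterval (j + n + 1) 1) := by
    refine integrableOn_iUnion_of_summable_integral_norm hint ?_
    simp only [hnorm]
    exact hsum.summable.norm.mul_left _
  refine ⟨hI.congr_set_ae (dyadicInterval_zero_ae_eq j), ?_⟩
  rw [setAverage_dyadicInterval, setIntegral_congr_set (dyadicInterval_zero_ae_eq j)]
  have h1 := hasSum_integral_iUnion hmeas hdisj hI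
  simp only [hval] at h1
  rw [h1.unique (hsum.mul_left _), zpow_neg]
  have : 2 - ρ ≠ 0 := by linarith
  have : 1 - ρ / 2 ≠ 0 := by linarith
  field_simp

/-- The weight equal to `a ^ (-m)` on `[2 ^ m, 2 ^ (m + 1))` for every integer `m`, and to `1` on
`(-∞, 0]`, where `Int.log` takes the value `0`. -/
noncomputable def stepPowerWeight (a : ℝ) (x : ℝ) : ℝ := a ^ (-Int.log 2 x)

theorem stepPowerWeight_pos {a : ℝ} (ha : 0 < a) (x : ℝ) : 0 < stepPowerWeight a x :=
  zpow_pos ha _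

theorem stepPowerWeight_of_mem {a : ℝ} (ha : 0 < a) {j : ℤ} {n : ℕ} {x : ℝ}
    (hx : x ∈ dyadicInterval (j + n + 1) 1) : stepPowerWeight a x = a ^ j * a ^ (n + 1) := by
  have h := int_log_two_of_mem_dyadicInterval le_rfl hx
  rw [Int.cast_one, Int.log_one_right] at h
  rw [stepPowerWeight, h, show -(0 - (j + n + 1)) = j + ((n + 1 : ℕ) : ℤ) by push_cast; ring,
    zpow_add₀ ha.ne', zpow_natCast]

theorem log_stepPowerWeight_of_mem {a : ℝ} (ha : 0 < a) {j : ℤ} {n : ℕ} {x : ℝ}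
    (hx : x ∈ dyadicInterval (j + n + 1) 1) :
    Real.log (stepPowerWeight a x) = j * Real.log a + Real.log a * (n + 1) := by
  rw [stepPowerWeight_of_mem ha hx, Real.log_mul (by positivity) (by positivity), Real.log_zpow,
    Real.log_pow]
  push_cast
  ring

theorem stepPowerWeight_average {a : ℝ} (ha : 0 < a) (ha2 : a < 2) (j : ℤ) :
    IntegrableOn (stepPowerWeight a) (dyadicInterval j 0) ∧
      ⨍ x in dyadicInterval j 0, stepPowerWeight a x = a ^ j * (a / (2 - a)) := by
  have h := average_of_eq_affine_mul_pow (f := stepPowerWeight a) (j := j) (α := a ^ j) (β := 0)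
    ha ha2 fun n x hx => by rw [stepPowerWeight_of_mem ha hx]; ring
  simpa using h

theorem stepPowerWeight_average_log {a : ℝ} (ha : 0 < a) (j : ℤ) :
    IntegrableOn (fun x => Real.log (stepPowerWeight a x)) (dyadicInterval j 0) ∧
      ⨍ x in dyadicInterval j 0, Real.log (stepPowerWeight a x) = (j + 2) * Real.log a := by
  have h := average_of_eq_affine_mul_pow (f := fun x => Real.log (stepPowerWeight a x)) (j := j)
    (α := j * Real.log a) (β := Real.log a) one_pos one_lt_two
    fun n x hx => by rw [log_stepPowerWeight_of_mem ha hx]; ring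
  refine ⟨h.1, h.2.trans ?_⟩
  norm_num
  ring

theorem stepPowerWeight_average_mul_log {a : ℝ} (ha : 0 < a) (ha2 : a < 2) :
    IntegrableOn (fun x => stepPowerWeight a x * Real.log (stepPowerWeight a x))
        (dyadicInterval 0 0) ∧
      ⨍ x in dyadicInterval 0 0, stepPowerWeight a x * Real.log (stepPowerWeight a x) =
        Real.log a * (2 * a / (2 - a) ^ 2) := by
  have h := average_of_eq_affine_mul_pow
    (f := fun x => stepPowerWeight a x * Real.log (stepPowerWeight a x)) (j := 0)
    (α := 0) (β := Real.log a) ha ha2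
    fun n x hx => by
      rw [log_stepPowerWeight_of_mem ha hx, stepPowerWeight_of_mem ha hx]
      simp
      ring
  simpa using h

theorem stepPowerWeight_const (a : ℝ) (j : ℤ) {k : ℤ} (hk : k ≠ 0) :
    ∃ m : ℤ, ∀ x ∈ dyadicInterval j k, stepPowerWeight a x = a ^ m := by
  rcases lt_or_gt_of_ne hk with h | h
  · refine ⟨0, fun x hx => ?_⟩
    have h1 : (k : ℝ) + 1 ≤ 0 := by exact_mod_cast h
    have hx0 : x ≤ 0 := hx.2.le.trans (mul_nonpos_of_nonpos_of_nonneg h1 (by positivity))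
    rw [stepPowerWeight, Int.log_of_right_le_zero _ hx0, neg_zero]
  · exact ⟨_, fun x hx => by rw [stepPowerWeight, int_log_two_of_mem_dyadicInterval h hx]⟩

theorem stepPowerWeight_integrableOn {a : ℝ} (ha : 0 < a) (ha2 : a < 2) (j k : ℤ) :
    IntegrableOn (stepPowerWeight a) (dyadicInterval j k) := by
  rcases eq_or_ne k 0 with rfl | hk
  · exact (stepPowerWeight_average ha ha2 j).1
  · obtain ⟨m, hm⟩ := stepPowerWeight_const a j hk
    exact (integrableOn_const_dyadicInterval (a ^ m) j k).congr_fun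
      (fun x hx => (hm x hx).symm) (measurableSet_dyadicInterval j k)

theorem isWeight_stepPowerWeight {a : ℝ} (ha : 0 < a) (ha2 : a < 2) :
    IsWeight (stepPowerWeight a) := by
  refine ⟨fun x => ?_, Filter.Eventually.of_forall (stepPowerWeight_pos ha)⟩
  obtain ⟨n, hn⟩ := pow_unbounded_of_one_lt |x| one_lt_two
  refine ⟨Set.Ioo (-2 ^ n) (2 ^ n), Ioo_mem_nhds (neg_lt_of_abs_lt hn) (lt_of_abs_lt hn), ?_⟩
  refine ((stepPowerWeight_integrableOn ha ha2 (-n) (-1)).union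
    (stepPowerWeight_integrableOn ha ha2 (-n) 0)).mono_set fun y hy => ?_
  simp only [dyadicInterval, neg_neg, zpow_natCast]
  rcases lt_or_ge y 0 with h | h
  · exact Or.inl ⟨by simpa using hy.1.le, by simpa using h⟩
  · exact Or.inr ⟨by simpa using h, by simpa using hy.2⟩

theorem dyadicAInftyConst_stepPowerWeight_le {a : ℝ} (ha : 0 < a) (ha2 : a < 2) :
    dyadicAInftyConst (stepPowerWeight a) ≤ ENNReal.ofReal (1 / (a * (2 - a))) := by
  have h2a : 0 < 2 - a := by linarith
  refine iSup₂_le fun j k => ?_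
  rcases eq_or_ne k 0 with rfl | hk
  · obtain ⟨h1, h2⟩ := stepPowerWeight_average_log ha j
    rw [if_pos h1, h2, (stepPowerWeight_average ha ha2 j).2]
    refine ENNReal.ofReal_le_ofReal (le_of_eq ?_)
    have : Real.exp (-(((j : ℝ) + 2) * Real.log a)) = (a ^ j * a ^ 2)⁻¹ := by
      rw [Real.exp_neg]
      congr 1
      rw [← Real.exp_log (show 0 < a ^ j * a ^ 2 by positivity),
        Real.log_mul (by positivity) (by positivity), Real.log_zpow, Real.log_pow]
      push_cast
      ring_nf
    rw [this]
    field_simp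
  · obtain ⟨m, hm⟩ := stepPowerWeight_const a j hk
    have hlog : ∀ x ∈ dyadicInterval j k,
        Real.log (stepPowerWeight a x) = Real.log (a ^ m) := fun x hx => by rw [hm x hx]
    have hi : IntegrableOn (fun x => Real.log (stepPowerWeight a x)) (dyadicInterval j k) :=
      (integrableOn_const_dyadicInterval (Real.log (a ^ m)) j k).congr_fun
        (fun x hx => (hlog x hx).symm) (measurableSet_dyadicInterval j k)
    have havg : ∀ c : ℝ, 2 ^ j * ∫ _ in dyadicInterval j k, c = c := fun c => by
      rw [setIntegral_const, volume_real_dyadicInterval, smul_eq_mul, zpow_neg]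
      field_simp
    rw [if_pos hi, setAverage_dyadicInterval, setAverage_dyadicInterval,
      setIntegral_congr_fun (measurableSet_dyadicInterval j k) hm,
      setIntegral_congr_fun (measurableSet_dyadicInterval j k) hlog, havg, havg, Real.exp_neg,
      Real.exp_log (by positivity), mul_inv_cancel₀ (by positivity)]
    refine ENNReal.ofReal_le_ofReal ((one_le_div (by positivity)).2 ?_)
    nlinarith [sq_nonneg (a - 1)]

theorem le_dyadicRHOneConst_stepPowerWeight {a : ℝ} (ha : 0 < a) (ha2 : a < 2) :
    ENNReal.ofReal (Real.log (2 - a) + a * Real.log a / (2 - a)) ≤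
      dyadicRHOneConst (stepPowerWeight a) := by
  have h2a : 0 < 2 - a := by linarith
  have hw := isWeight_stepPowerWeight ha ha2
  obtain ⟨h1, h2⟩ := stepPowerWeight_average_mul_log ha ha2
  refine le_iSup₂_of_le 0 0 ?_
  rw [if_pos (integrableOn_entropyDensity hw h1), average_entropyDensity hw h1, h2,
    (stepPowerWeight_average ha ha2 0).2, zpow_zero, one_mul, Real.log_div ha.ne' h2a.ne']
  refine ENNReal.ofReal_le_ofReal (le_of_eq ?_)
  field_simp
  ring

/-- Multiplied by `a (2 - a)`, the right side becomes `a (2 - a) log (2 - a) + a² log a`, which is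
continuous up to `a = 2`, with value `log 16` there. -/
theorem exists_entropy_gt {C : ℝ} (hC : C < Real.log 16) :
    ∃ a : ℝ, 0 < a ∧ a < 2 ∧
      C * (1 / (a * (2 - a))) < Real.log (2 - a) + a * Real.log a / (2 - a) := by
  have hcont : Continuous fun a : ℝ => a * ((2 - a) * Real.log (2 - a)) + a * (a * Real.log a) :=
    (continuous_id.mul (Real.continuous_mul_log.comp (continuous_const.sub continuous_id))).add
      (continuous_id.mul Real.continuous_mul_log)
  have hC' : C < (2 : ℝ) * ((2 - 2) * Real.log (2 - 2)) + 2 * (2 * Real.log 2) := by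
    rw [log_sixteen] at hC; linarith
  have h1 : ∀ᶠ a in nhdsWithin (2 : ℝ) (Set.Iio 2),
      C < a * ((2 - a) * Real.log (2 - a)) + a * (a * Real.log a) :=
    nhdsWithin_le_nhds (hcont.continuousAt.eventually_const_lt hC')
  obtain ⟨a, h, ha, ha2⟩ := (h1.and (Ioo_mem_nhdsLT (zero_lt_two' ℝ))).exists
  have h2a : 0 < 2 - a := by linarith
  refine ⟨a, ha, ha2, ?_⟩
  rw [mul_one_div, div_lt_iff₀ (by positivity)]
  refine h.trans_eq ?_
  field_simp

theorem theoremI5 :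
    (∀ w : ℝ → ℝ, IsDyadicAInfty w →
      IsDyadicRHOne w ∧
        dyadicRHOneConst w ≤ ENNReal.ofReal (Real.log 16) * dyadicAInftyConst w) ∧
    (∀ C : ℝ, C < Real.log 16 →
      ∃ w : ℝ → ℝ, IsDyadicAInfty w ∧
        ENNReal.ofReal C * dyadicAInftyConst w < dyadicRHOneConst w) := by
  refine ⟨fun w hw => ⟨⟨hw.1, hw.dyadicRHOneConst_le.trans_lt
    (ENNReal.mul_lt_top ENNReal.ofReal_lt_top hw.2)⟩, hw.dyadicRHOneConst_le⟩, fun C hC => ?_⟩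
  -- `ENNReal.ofReal` sends a negative `C` to `0`, so `C` may be replaced by `max C 0`
  obtain ⟨a, ha, ha2, h⟩ := exists_entropy_gt
    (max_lt hC (Real.log_pos (by norm_num : (1 : ℝ) < 16)))
  have hle := dyadicAInftyConst_stepPowerWeight_le ha ha2
  have h0 : 0 ≤ max C 0 * (1 / (a * (2 - a))) :=
    mul_nonneg (le_max_right _ _) (one_div_nonneg.2 (mul_nonneg ha.le (by linarith)))
  refine ⟨stepPowerWeight a, ⟨isWeight_stepPowerWeight ha ha2,
    hle.trans_lt ENNReal.ofReal_lt_top⟩, ?_⟩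
  calc ENNReal.ofReal C * dyadicAInftyConst (stepPowerWeight a)
      ≤ ENNReal.ofReal (max C 0) * ENNReal.ofReal (1 / (a * (2 - a))) := by
        gcongr; exact le_max_left _ _
    _ = ENNReal.ofReal (max C 0 * (1 / (a * (2 - a)))) :=
        (ENNReal.ofReal_mul (le_max_right _ _)).symm
    _ < ENNReal.ofReal (Real.log (2 - a) + a * Real.log a / (2 - a)) :=
        (ENNReal.ofReal_lt_ofReal_iff_of_nonneg h0).2 h
    _ ≤ dyadicRHOneConst (stepPowerWeight a) := le_dyadicRHOneConst_stepPowerWeight ha ha2
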